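/- A zero-error channel from $\mathcal X$ to $\mathcal Y$ is a relation $\mathcal W\subseteq\mathcal X\times\mathcal Y$ such that every $x\in\mathcal X$ is related to at least one $y\in\mathcal Y$; the $y$ with $(x,y)\in\mathcal W$ are the possible outputs on input $x$. A channel $\mathcal W_0\subseteq\mathcal X_0\times\mathcal Y_0$ can simulate a channel $\mathcal W_1\subseteq\mathcal X_1\times\mathcal Y_1$ if there are $N\in\mathbb N$, a sender map $\mathcal X_1\to\mathcal X_0^N$ and a receiver map $\mathcal Y_0^N\to\mathcal Y_1$ such that, for every input $x\in\mathcal X_1$ and all possible outputs of the $N$ invocations of $\mathcal W_0$, the receiver's output $y$ satisfies $(x,y)\in\mathcal W_1$. The $\mathrm{List}(1)$ channel is the channel with inputs $\{1,2\}$, with outputs the one-element subsets $y$ of $\{1,2\}$, and with $(x,y)$ possible if and only if $x\in y$. Consider $n$ parallel $\mathrm{List}(1)$ channels of which up to $t$ may be corrupted: in each joint use the sender sends one symbol over each channel, and all channels outside an unknown set $C$ of at most $t$ corrupted channels behave as specified, while the channels in $C$ may output arbitrary elements of the output range. **Corollary.** Let $n,t\ge 0$ be integers. A $\mathrm{List}(1)$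 channel can be simulated by $n$ $\mathrm{List}(1)$ channels of which up to $t$ may be corrupted if and only if $n>2t$. This holds both when the parallel concatenation is regarded as a single zero-error channel, so that $C$ may be different in each joint use, and when $C$ is the same in all joint uses of one execution of the protocol. -/

import Mathlib

/-- A zero-error channel with input domain `X` and output range `Y`: a relation recording which
outputs are possible on each input, such that every input has at least one possible output. -/
structure ZChannel (X Y : Type*) where
  /-- `rel x y` means that the output `y` is possible on the input `x`. -/
  rel : X → Y → Prop
  total : ∀ x, ∃ y, rel x y

namespace ZChannel

/-- `W₀.Achieves W₁`: the channel `W₁` is achievable by `W₀`. There is a protocol that invokes `W₀`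
some number `N` of times (the sender computes the symbols it sends from its input, the receiver
computes its output from the symbols it receives) such that for every input and for every possible
output of the channel invocations, the result satisfies the requirements of `W₁`. -/
def Achieves {X₀ Y₀ X₁ Y₁ : Type*} (W₀ : ZChannel X₀ Y₀) (W₁ : ZChannel X₁ Y₁) : Prop :=
  ∃ (N : ℕ) (send : X₁ → Fin N → X₀) (receive : (Fin N → Y₀) → Y₁),
    ∀ (x : X₁) (v : Fin N → Y₀), (∀ k, W₀.rel (send x k) (v k)) → W₁.rel x (receive v)

/-- The `List(a, d)` channel, `0 < a < d`: the inputs are the elements of a set of size `d`, the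
outputs are its subsets of size `a`, and the output must contain the input. -/
def list (a d : ℕ) (ha : 0 < a) (had : a < d) :
    ZChannel (Fin d) {y : Finset (Fin d) // y.card = a} where
  rel x y := x ∈ y.1
  total x := by
    obtain ⟨y, hxy, -, hy⟩ := Finset.exists_subsuperset_card_eq
      (Finset.subset_univ ({x} : Finset (Fin d))) (n := a) (by simpa using Nat.succ_le_of_lt ha)
      (by simpa using had.le)
    exact ⟨⟨y, hy⟩, hxy (Finset.mem_singleton_self x)⟩

/-- `List(1)`, the short form of `List(1, 2)`. -/
def listOne : ZChannel (Fin 2) {y : Finset (Fin 2) // y.card = 1} :=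
  list 1 2 Nat.one_pos Nat.one_lt_two

/-- The parallel concatenation of the channels `W j` with the honest set structure `H`, as a
zero-error channel. In each invocation one symbol is sent over each channel, and for some honest set
`h ∈ H` the channels in `h` behave as specified, while the others output arbitrary symbols. -/
def parallel {ι : Type*} {X Y : ι → Type*} (W : ∀ j, ZChannel (X j) (Y j))
    (H : Set (Finset ι)) (hH : H.Nonempty) : ZChannel (∀ j, X j) (∀ j, Y j) where
  rel x y := ∃ h ∈ H, ∀ j ∈ h, (W j).rel (x j) (y j)
  total x := by
    choose f hf using fun j => (W j).total (x j)
    obtain ⟨h, hh⟩ := hH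
    exact ⟨f, h, hh, fun j _ => hf j⟩

/-- `V` can be simulated by the parallel channels `W j` with honest set structure `H`, where the
unknown honest set `h ∈ H` stays the same during the whole execution of the protocol. -/
def ParallelAchieves {ι : Type*} {X Y : ι → Type*} {X₁ Y₁ : Type*}
    (W : ∀ j, ZChannel (X j) (Y j)) (H : Set (Finset ι)) (V : ZChannel X₁ Y₁) : Prop :=
  ∃ (N : ℕ) (send : X₁ → Fin N → ∀ j, X j) (receive : (Fin N → ∀ j, Y j) → Y₁),
    ∀ h ∈ H, ∀ (x : X₁) (v : Fin N → ∀ j, Y j),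
      (∀ k, ∀ j ∈ h, (W j).rel (send x k j) (v k j)) → V.rel x (receive v)

/-- The threshold honest set structure on `n` channels: up to `t` of them are not honest. -/
def threshold (n t : ℕ) : Set (Finset (Fin n)) := {h | hᶜ.card ≤ t}

theorem threshold_nonempty (n t : ℕ) : (threshold n t).Nonempty :=
  ⟨Finset.univ, by simp [threshold]⟩

end ZChannel

/-! A fixed corrupted set is the weaker adversary, so it suffices to prove necessity against it
(`lt_of_parallelAchieves_threshold`) and sufficiency against the varying one
(`parallel_listOne_achieves`). If `n ≤ 2 * t`, two complementary sets can both be honest, and one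
transcript is consistent with both inputs. If `n > 2 * t`, the honest channels outvote the corrupted
ones. -/

namespace ZChannel

/-- If the honest set may differ in each joint use, it may in particular stay the same. -/
theorem Achieves.parallelAchieves {ι : Type*} {X Y : ι → Type*} {X₁ Y₁ : Type*}
    {W : ∀ j, ZChannel (X j) (Y j)} {H : Set (Finset ι)} {hH : H.Nonempty} {V : ZChannel X₁ Y₁}
    (hA : (parallel W H hH).Achieves V) : ParallelAchieves W H V := by
  obtain ⟨N, send, receive, hp⟩ := hA
  exact ⟨N, send, receive, fun h hh x v hv => hp x v fun k => ⟨h, hh, hv k⟩⟩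

/-- A one-element set does not contain both inputs. -/
theorem not_zero_mem_and_one_mem (y : {y : Finset (Fin 2) // y.card = 1}) :
    ¬ ((0 : Fin 2) ∈ y.1 ∧ (1 : Fin 2) ∈ y.1) := by
  rintro ⟨h0, h1⟩
  exact zero_ne_one (Finset.card_le_one.1 y.2.le 0 h0 1 h1)

/-- Disjoint honest sets rule out the simulation of `List(1)`: if one of them carries the messages
for the input `0` and the rest those for the input `1`, the receiver must satisfy both inputs. -/
theorem not_parallelAchieves_listOne {ι : Type*} {X Y : ι → Type*}
    (W : ∀ j, ZChannel (X j) (Y j)) {H : Set (Finset ι)} {h h' : Finset ι} (hh : h ∈ H)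
    (hh' : h' ∈ H) (hd : Disjoint h h') : ¬ ParallelAchieves W H listOne := by
  classical
  rintro ⟨N, send, receive, hp⟩
  choose f hf using fun j => (W j).total
  let v : Fin N → ∀ j, Y j := fun k j => if j ∈ h then f j (send 0 k j) else f j (send 1 k j)
  refine not_zero_mem_and_one_mem (receive v) ⟨hp h hh 0 v ?_, hp h' hh' 1 v ?_⟩
  · intro k j hj
    simpa [v, hj] using hf j (send 0 k j)
  · intro k j hj
    simpa [v, Finset.disjoint_right.1 hd hj] using hf j (send 1 k j)

theorem lt_of_parallelAchieves_threshold {n t : ℕ} {X Y : Fin n → Type*}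
    {W : ∀ j, ZChannel (X j) (Y j)} (hA : ParallelAchieves W (threshold n t) listOne) :
    2 * t < n := by
  by_contra! hn
  -- `h` and its complement must both have size at most `t`; the minimum covers `t > n`.
  obtain ⟨h, -, hc⟩ := Finset.exists_subset_card_eq (s := (Finset.univ : Finset (Fin n)))
    (n := min t n) (by simp)
  refine not_parallelAchieves_listOne W (h := h) (h' := hᶜ) ?_ ?_ disjoint_compl_right hA
  · simp only [threshold, Set.mem_ofPred_eq, Finset.card_compl, Fintype.card_fin]
    omega
  · simp only [threshold, Set.mem_ofPred_eq, compl_compl]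
    omega

/-- With a corrupted minority, a single joint use and a majority vote suffice. -/
theorem parallel_listOne_achieves {n t : ℕ} (hn : 2 * t < n) :
    (parallel (fun _ : Fin n => listOne) (threshold n t) (threshold_nonempty n t)).Achieves
      listOne := by
  let ones (y : Fin n → {y : Finset (Fin 2) // y.card = 1}) : Finset (Fin n) :=
    Finset.univ.filter fun j => 1 ∈ (y j).1
  refine ⟨1, fun x _ _ => x,
    -- More than `t` votes for `1` cannot all come from corrupted channels.
    fun v => if t < (ones (v 0)).card then ⟨{1}, Finset.card_singleton 1⟩ else ⟨{0}, Finset.card_singleton 0⟩, fun x v hv => ?_⟩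
  obtain ⟨h, hh, hrel⟩ := hv 0
  replace hrel : ∀ j ∈ h, x ∈ (v 0 j).1 := hrel
  replace hh : hᶜ.card ≤ t := hh
  match x with
  | 0 =>
    have hsub : ones (v 0) ⊆ hᶜ := fun j hj => Finset.mem_compl.2 fun hjh =>
      not_zero_mem_and_one_mem _ ⟨hrel j hjh, (Finset.mem_filter.1 hj).2⟩
    beta_reduce
    rw [if_neg (Nat.not_lt.2 ((Finset.card_le_card hsub).trans hh))]
    exact Finset.mem_singleton_self _
  | 1 =>
    have hsub : h ⊆ ones (v 0) := fun j hj =>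
      Finset.mem_filter.2 ⟨Finset.mem_univ j, hrel j hj⟩
    have hle := Finset.card_le_card hsub
    have hadd := Finset.card_add_card_compl h
    rw [Fintype.card_fin] at hadd
    beta_reduce
    -- At least `n - t > t` honest channels vote for `1`.
    rw [if_pos (by omega)]
    exact Finset.mem_singleton_self _

end ZChannel

theorem mainTheorem9 (n t : ℕ) :
    ((ZChannel.parallel (fun _ : Fin n => ZChannel.listOne) (ZChannel.threshold n t)
        (ZChannel.threshold_nonempty n t)).Achieves ZChannel.listOne ↔ n > 2 * t) ∧
    (ZChannel.ParallelAchieves (fun _ : Fin n => ZChannel.listOne) (ZChannel.threshold n t)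
        ZChannel.listOne ↔ n > 2 * t) :=
  ⟨⟨fun hA => ZChannel.lt_of_parallelAchieves_threshold hA.parallelAchieves,
      ZChannel.parallel_listOne_achieves⟩,
    ⟨ZChannel.lt_of_parallelAchieves_threshold,
      fun hn => (ZChannel.parallel_listOne_achieves hn).parallelAchieves⟩⟩
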